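/- Let $n\ge 0$, let $\mathbb P^n$ be the projective space over $\mathbb C$ and $(\mathbb P^n)^*$ its dual. For an irreducible locally closed $S\subseteq\mathbb P^n$, let $I_S\subseteq\mathbb C[x_0,\dots,x_n]$ be its homogeneous vanishing ideal, $\mathrm{Reg}(S)$ the set of its smooth points, and $T_xS\subseteq\mathbb C^{n+1}$ the linear subspace corresponding to its projective tangent space at $x$. The conormal space $C(S)\subseteq\mathbb P^n\times(\mathbb P^n)^*$ is the Zariski closure of $\{(x,l) : x\in\mathrm{Reg}(S),\ l|_{T_xS}=0\}$, and $I_{C(S)}\subseteq\mathbb C[x_0,\dots,x_n,l_0,\dots,l_n]$ is its bihomogeneous vanishing ideal (for $S=\varnothing$ one has $C(S)=\varnothing$, and the vanishing ideal of the empty set is the unit ideal). Let $X\subseteq\mathbb P^n$ be an irreducible projective variety, let $Y\subsetneq X$ be an irreducible closed subvariety, and let $\kappa_X\colon C(X)\to X$, $(x,l)\mapsto x$. Put $$I_{C(X)\cap C(Y)}=I_{C(X)}+I_{C(Y)},\qquad I_{\kappa_X^{-1}(Y)}=I_{C(X)}+I_Y,\qquad Q=I_{\kappa_X^{-1}(Y)}:I_{C(X)\cap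 C(Y)}^{\infty}=\bigcup_{N\ge 0}\bigl(I_{\kappa_X^{-1}(Y)}:I_{C(X)\cap C(Y)}^{N}\bigr),$$ where $I_Y$ is extended to $\mathbb C[x_0,\dots,x_n,l_0,\dots,l_n]$, and $$U=\mathrm{Reg}(Y)\setminus\kappa_X(\mathbf V(Q)),$$ where $\mathbf V(Q)\subseteq\mathbb P^n\times(\mathbb P^n)^*$ is the zero set of $Q$. Let $I_{C(X)\cap C(U)}=I_{C(X)}+I_{C(U)}$, and let $I_{\kappa_X^{-1}(U)}$ be the ideal of the scheme-theoretic closure of $\kappa_X^{-1}(U)$ in $\mathbb P^n\times(\mathbb P^n)^*$, i.e. the ideal of all polynomials $F$ such that at each point $(x,l)$ with nonzero coordinate vectors that represents a point of $\kappa_X^{-1}(U)$ there is a polynomial $g$ with $g(x,l)\neq 0$ and $gF\in I_{C(X)}+I_U$. Then $$\sqrt{I_{C(X)\cap C(U)}}\subseteq\sqrt{I_{\kappa_X^{-1}(U)}}.$$ Moreover, $(\mathrm{Reg}(X),U)$ satisfies Whitney's condition (a): for every $y\in U$ and every sequence $x_k\in\mathrm{Reg}(X)$ converging to $y$ in the Euclidean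 topology of $\mathbb P^n$ such that $T_{x_k}\mathrm{Reg}(X)$ converges to a linear subspace $T$ in the Euclidean topology of the Grassmannian, one has $T_yU\subseteq T$. -/

import Mathlib

noncomputable section

open MvPolynomial Filter Topology
open scoped LinearAlgebra.Projectivization

namespace ProjVar

/-! ### Projective varieties over `ℂ` -/

/-- Complex projective space of dimension `n`, with homogeneous coordinates `x₀, …, xₙ`.
The dual projective space is identified with it through the dual coordinates `l₀, …, lₙ`. -/
abbrev PSpace (n : ℕ) : Type := ℙ ℂ (Fin (n + 1) → ℂ)

variable {n : ℕ}

/-- `u` is a vector of homogeneous coordinates of the point `p`. -/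
def IsRep (u : Fin (n + 1) → ℂ) (p : PSpace n) : Prop :=
  ∃ hu : u ≠ 0, Projectivization.mk ℂ u hu = p

/-- The punctured affine cone over a set of points of projective space. -/
def cone (S : Set (PSpace n)) : Set (Fin (n + 1) → ℂ) :=
  {u | ∃ p ∈ S, IsRep u p}

/-- The (homogeneous) vanishing ideal of a set of points of projective space. -/
def pIdeal (S : Set (PSpace n)) : Ideal (MvPolynomial (Fin (n + 1)) ℂ) :=
  vanishingIdeal ℂ (cone S)

/-- Zariski closed subsets: common zeros of families of homogeneous polynomials. -/
def IsZariskiClosed (S : Set (PSpace n)) : Prop :=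
  ∃ F : Set (MvPolynomial (Fin (n + 1)) ℂ),
    (∀ f ∈ F, ∃ d : ℕ, f.IsHomogeneous d) ∧
      S = {p | ∀ u, IsRep u p → ∀ f ∈ F, aeval u f = 0}

/-- Irreducible (closed) projective varieties. -/
structure IsIrreducibleVariety (S : Set (PSpace n)) : Prop where
  closed : IsZariskiClosed S
  nonempty : S.Nonempty
  irreducible : ∀ A B : Set (PSpace n), IsZariskiClosed A → IsZariskiClosed B →
    S ⊆ A ∪ B → S ⊆ A ∨ S ⊆ B

/-- The embedded tangent space at `p` of an irreducible locally closed set `S`, as a linear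
subspace of `ℂⁿ⁺¹` (the tangent space of the affine cone over `S` along the line `p`):
the vectors killed by the differentials of all equations of `S`. It contains the line `p`
if `p ∈ S`, and its projectivization is the projective tangent space of `S` at `p`. -/
def tangentSpace (S : Set (PSpace n)) (p : PSpace n) : Submodule ℂ (Fin (n + 1) → ℂ) where
  carrier := {v | ∀ f ∈ pIdeal S, ∀ u, IsRep u p → ∑ i, aeval u (pderiv i f) * v i = 0}
  zero_mem' := fun f _ u _ => by simp
  add_mem' := fun {v w} hv hw f hf u hu => by
    simp only [Pi.add_apply, mul_add, Finset.sum_add_distrib]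
    rw [hv f hf u hu, hw f hf u hu, add_zero]
  smul_mem' := fun c v hv f hf u hu => by
    have h : ∑ i, aeval u (pderiv i f) * (c • v) i = c * ∑ i, aeval u (pderiv i f) * v i := by
      rw [Finset.mul_sum]
      exact Finset.sum_congr rfl fun i _ => by simp only [Pi.smul_apply, smul_eq_mul]; ring
    rw [h, hv f hf u hu, mul_zero]

/-- The dimension of the affine cone over `S`, that is `dim S + 1`: the transcendence degree of
the homogeneous coordinate ring of (the closure of) `S`. -/
def coneDim (S : Set (PSpace n)) : Cardinal :=
  Algebra.trdeg ℂ (MvPolynomial (Fin (n + 1)) ℂ ⧸ pIdeal S)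

/-- The regular (smooth) points of an irreducible locally closed set `S`, by the Jacobian
criterion: those at which the tangent space has the dimension of `S`. -/
def Reg (S : Set (PSpace n)) : Set (PSpace n) :=
  {p | p ∈ S ∧ (Module.finrank ℂ (tangentSpace S p) : Cardinal) = coneDim S}

/-! ### The product with the dual space, and conormal spaces -/

/-- The punctured bi-cone over a subset of `ℙⁿ × (ℙⁿ)*`: pairs `(u, w)` of coordinate vectors,
`Sum.inl` indexing the coordinates on `ℙⁿ` and `Sum.inr` those on `(ℙⁿ)*`. -/
def biCone (W : Set (PSpace n × PSpace n)) : Set (Fin (n + 1) ⊕ Fin (n + 1) → ℂ) :=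
  {z | ∃ q ∈ W, IsRep (z ∘ Sum.inl) q.1 ∧ IsRep (z ∘ Sum.inr) q.2}

/-- The (bihomogeneous) vanishing ideal of a subset of `ℙⁿ × (ℙⁿ)*`. -/
def biIdeal (W : Set (PSpace n × PSpace n)) :
    Ideal (MvPolynomial (Fin (n + 1) ⊕ Fin (n + 1)) ℂ) :=
  vanishingIdeal ℂ (biCone W)

/-- The zero set `V(I)` in `ℙⁿ × (ℙⁿ)*` of an ideal. -/
def biZeros (I : Ideal (MvPolynomial (Fin (n + 1) ⊕ Fin (n + 1)) ℂ)) :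
    Set (PSpace n × PSpace n) :=
  {q | biCone {q} ⊆ zeroLocus ℂ I}

/-- The hyperplane `l` vanishes on the linear subspace `T` of `ℂⁿ⁺¹`. -/
def Annihilates (l : PSpace n) (T : Submodule ℂ (Fin (n + 1) → ℂ)) : Prop :=
  ∀ w, IsRep w l → ∀ v ∈ T, ∑ i, w i * v i = 0

/-- The conormal space `C(S)`: the (Zariski) closure in `ℙⁿ × (ℙⁿ)*` of the set of pairs
`(x, l)` with `x` a regular point of `S` and `l` vanishing on the tangent space at `x`. -/
def conormal (S : Set (PSpace n)) : Set (PSpace n × PSpace n) :=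
  biZeros (biIdeal {q | q.1 ∈ Reg S ∧ Annihilates q.2 (tangentSpace S q.1)})

/-- The conormal map `κ_X : C(X) → X`, `(x, l) ↦ x`. -/
def kappa (X : Set (PSpace n)) : conormal X → PSpace n := fun q => q.1.1

/-! ### The ideals -/

/-- `I_{C(X)} + I_{C(S)}`, defining `C(X) ∩ C(S)`. -/
def interIdeal (X S : Set (PSpace n)) : Ideal (MvPolynomial (Fin (n + 1) ⊕ Fin (n + 1)) ℂ) :=
  biIdeal (conormal X) ⊔ biIdeal (conormal S)

/-- `I_{C(X)} + I_S`, where `I_S` is extended to the ring of all the variables. For a closed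
`S ⊆ X` it defines `κ_X⁻¹(S)`. -/
def fibreIdeal (X S : Set (PSpace n)) : Ideal (MvPolynomial (Fin (n + 1) ⊕ Fin (n + 1)) ℂ) :=
  biIdeal (conormal X) ⊔ (pIdeal S).map (rename Sum.inl)

/-- The polynomials whose germs at all points of `W` lie in the ideal `I`. If `W` is open in
`V(I)`, this ideal defines the scheme-theoretic closure in `ℙⁿ × (ℙⁿ)*` of the open subscheme
of `V(I)` with underlying set `W`; if `W = V(I)`, it defines the same sheaf of ideals
as `I`. -/
def idealAlong (I : Ideal (MvPolynomial (Fin (n + 1) ⊕ Fin (n + 1)) ℂ))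
    (W : Set (PSpace n × PSpace n)) : Ideal (MvPolynomial (Fin (n + 1) ⊕ Fin (n + 1)) ℂ) where
  carrier := {F | ∀ z ∈ biCone W, ∃ g, aeval z g ≠ 0 ∧ g * F ∈ I}
  zero_mem' := fun z _ => ⟨1, by simp, by simp⟩
  add_mem' := fun {F G} hF hG z hz => by
    obtain ⟨a, ha, haF⟩ := hF z hz
    obtain ⟨b, hb, hbG⟩ := hG z hz
    refine ⟨a * b, by simpa using ⟨ha, hb⟩, ?_⟩
    have h : a * b * (F + G) = b * (a * F) + a * (b * G) := by ring
    rw [h]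
    exact I.add_mem (I.mul_mem_left b haF) (I.mul_mem_left a hbG)
  smul_mem' := fun c F hF z hz => by
    obtain ⟨a, ha, haF⟩ := hF z hz
    refine ⟨a, ha, ?_⟩
    have h : a * (c • F) = c * (a * F) := by rw [smul_eq_mul]; ring
    rw [h]
    exact I.mul_mem_left c haF

/-- The ideal of `κ_X⁻¹(U)` for a locally closed set `U` in `X`. -/
def preimageIdeal (X U : Set (PSpace n)) :
    Ideal (MvPolynomial (Fin (n + 1) ⊕ Fin (n + 1)) ℂ) :=
  idealAlong (fibreIdeal X U) (Subtype.val '' (kappa X ⁻¹' U))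

/-- The saturation `I : J^∞`, the union of the ascending chain of ideals `I : J^N`. -/
def saturation {R : Type*} [CommRing R] (I J : Ideal R) : Ideal R :=
  ⨆ N : ℕ, I.colon ((J ^ N : Ideal R) : Set R)

/-- `Q = I_{κ⁻¹(Y)} : I_{C(X) ∩ C(Y)}^∞`. -/
def satIdeal (X Y : Set (PSpace n)) : Ideal (MvPolynomial (Fin (n + 1) ⊕ Fin (n + 1)) ℂ) :=
  saturation (fibreIdeal X Y) (interIdeal X Y)

/-- `U = Reg(Y) \ κ_X(V(Q))`. -/
def goodLocus (X Y : Set (PSpace n)) : Set (PSpace n) :=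
  Reg Y \ (kappa X '' {q | q.1 ∈ biZeros (satIdeal X Y)})

/-! ### Whitney's condition (a) -/

/-- Orthogonal projection of the Hermitian space `ℂⁿ⁺¹` onto a linear subspace. -/
def orthProj (T : Submodule ℂ (Fin (n + 1) → ℂ)) :
    EuclideanSpace ℂ (Fin (n + 1)) →L[ℂ] EuclideanSpace ℂ (Fin (n + 1)) :=
  (T.map (WithLp.linearEquiv 2 ℂ (Fin (n + 1) → ℂ)).symm.toLinearMap).starProjection

/-- Convergence of linear subspaces of `ℂⁿ⁺¹` in the Euclidean topology of the Grassmannian,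
which is the topology of the space of orthogonal projection matrices. -/
def SubspaceTendsto (T : ℕ → Submodule ℂ (Fin (n + 1) → ℂ))
    (T₀ : Submodule ℂ (Fin (n + 1) → ℂ)) : Prop :=
  Tendsto (fun k => orthProj (T k)) atTop (𝓝 (orthProj T₀))

/-- Whitney's condition (a) for the pair `(A, B)` at every point of `B`. Convergence of points
of `ℙⁿ` is that of lines in `ℂⁿ⁺¹`. -/
def WhitneyA (A B : Set (PSpace n)) : Prop :=
  ∀ y ∈ B, ∀ x : ℕ → PSpace n, (∀ k, x k ∈ A) →
    SubspaceTendsto (fun k => (x k).submodule) y.submodule →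
    ∀ T : Submodule ℂ (Fin (n + 1) → ℂ),
      SubspaceTendsto (fun k => tangentSpace A (x k)) T → tangentSpace B y ≤ T

end ProjVar

end

namespace ProjVar

open MvPolynomial Filter Topology

/-! ### Ranks and minors -/

/-! Since I_{C(X)} lies in Q, a zero of Q over a point y of U would be a point of C(X) mapping to y,
which U excludes. So at each (y, l) with y in U some g in Q is nonzero (`exists_satIdeal_ne_zero`).
By Noetherianity one N gives g·f^N ∈ I_{C(X)} + I_Y for all f in I_{C(X)} + I_{C(Y)}. As g is a unit
near (y, l), C(X) lies in C(Y) over U, set-theoretically and up to nilpotents.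

For the ideal inclusion, I_{C(U)} must be compared with I_{C(Y)}. U is open in Y: regularity is
detected by Jacobian minors, and the projection of V(Q) is closed by elimination theory
(`exists_basicOpen_subset_goodLocus`). Hence some h is nonzero at the given point and vanishes on Y
outside U; multiplication by h carries I_{C(U)} into I_{C(Y)}.

For condition (a), let v ∈ T_yU and let d be the component of v orthogonal to T. The conjugate of d
is a limit of conormal vectors of X at x_k, so if d ≠ 0 it gives a point of C(X) over y, hence of
C(Y). Over Reg(Y) points of C(Y) are genuine conormal vectors (`sum_mul_eq_zero_of_conormal`), so d
is orthogonal to v, whence d = 0. -/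

theorem exists_linearIndependent_of_le_finrank_span {k ι V : Type*} [Field k] [AddCommGroup V]
    [Module k V] [FiniteDimensional k V] {r : ℕ} {a : ι → V}
    (h : r ≤ Module.finrank k (Submodule.span k (Set.range a))) :
    ∃ s : Fin r → ι, LinearIndependent k (a ∘ s) := by
  obtain ⟨f, hf, -, hli⟩ := Submodule.exists_fun_fin_finrank_span_eq k (Set.range a)
  choose s hs using hf
  refine ⟨s ∘ Fin.castLE h, ?_⟩
  convert hli.comp (Fin.castLE h) (Fin.castLE_injective h) using 1
  ext i : 1
  simp [hs]

/-- The span of a family of vectors has dimension at least `r` iff some `r × r` minor is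
nonzero. -/
theorem le_finrank_span_iff {k ι : Type*} [Field k] {r m : ℕ} (a : ι → Fin m → k) :
    r ≤ Module.finrank k (Submodule.span k (Set.range a)) ↔
      ∃ (s : Fin r → ι) (c : Fin r → Fin m), (Matrix.of fun i j => a (s i) (c j)).det ≠ 0 := by
  constructor
  · intro h
    obtain ⟨s, hs⟩ := exists_linearIndependent_of_le_finrank_span h
    -- Row rank equals column rank, so the r independent rows contain r independent columns.
    have hr : Module.finrank k (Submodule.span k
        (Set.range (Matrix.of fun i j => a (s i) j).col)) = r := by
      rw [← Matrix.rank_eq_finrank_span_cols, LinearIndependent.rank_matrix (by exact hs),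
        Fintype.card_fin]
    obtain ⟨c, hc⟩ := exists_linearIndependent_of_le_finrank_span hr.ge
    refine ⟨s, c, fun h0 => ?_⟩
    have hu : IsUnit (Matrix.of fun i j => a (s i) (c j)) :=
      Matrix.linearIndependent_cols_iff_isUnit.mp hc
    exact ((Matrix.isUnit_iff_isUnit_det _).mp hu).ne_zero h0
  · rintro ⟨s, c, hdet⟩
    have hli : LinearIndependent k (Matrix.row (Matrix.of fun i j => a (s i) (c j))) :=
      Matrix.linearIndependent_rows_of_det_ne_zero hdet
    have hli' : LinearIndependent k (a ∘ s) :=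
      LinearIndependent.of_comp (LinearMap.funLeft k k c) hli
    calc r = Module.finrank k (Submodule.span k (Set.range (a ∘ s))) := by
          rw [finrank_span_eq_card hli', Fintype.card_fin]
      _ ≤ _ := Submodule.finrank_mono (Submodule.span_mono (Set.range_comp_subset_range s a))

theorem sum_mul_eq_zero_of_mem_span {k ι : Type*} [Field k] {m : ℕ} {a : ι → Fin m → k}
    {w v : Fin m → k} (hw : w ∈ Submodule.span k (Set.range a))
    (hv : ∀ i, ∑ j, a i j * v j = 0) : ∑ j, w j * v j = 0 := by
  induction hw using Submodule.span_induction with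
  | mem x hx => obtain ⟨i, rfl⟩ := hx; exact hv i
  | zero => simp
  | add x y _ _ hx hy => simp [add_mul, Finset.sum_add_distrib, hx, hy]
  | smul c x _ hx => simp [mul_assoc, ← Finset.mul_sum, hx]

/-- The dimension of the common kernel of a family of linear forms. -/
theorem finrank_annihilator_add {k ι : Type*} [Field k] {m : ℕ} (a : ι → Fin m → k)
    (T : Submodule k (Fin m → k)) (hT : ∀ v, v ∈ T ↔ ∀ i, ∑ j, a i j * v j = 0) :
    Module.finrank k (Submodule.span k (Set.range a)) + Module.finrank k T = m := by
  obtain ⟨s, hs⟩ := exists_linearIndependent_of_le_finrank_span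
    (le_refl (Module.finrank k (Submodule.span k (Set.range a))))
  have hspan : Submodule.span k (Set.range (a ∘ s)) = Submodule.span k (Set.range a) :=
    Submodule.eq_of_le_of_finrank_eq
      (Submodule.span_mono (Set.range_comp_subset_range s a))
      (by rw [finrank_span_eq_card hs, Fintype.card_fin])
  let M := Matrix.of fun i j => a (s i) j
  have hker : T = LinearMap.ker M.mulVecLin := by
    ext v
    rw [hT, LinearMap.mem_ker]
    constructor
    · intro h
      ext i
      exact h (s i)
    · intro h i
      have hi : a i ∈ Submodule.span k (Set.range (a ∘ s)) := by
        rw [hspan]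
        exact Submodule.subset_span ⟨i, rfl⟩
      exact sum_mul_eq_zero_of_mem_span hi fun i => congrFun h i
  have hrank : M.rank = Module.finrank k (Submodule.span k (Set.range a)) := by
    rw [LinearIndependent.rank_matrix (by exact hs), Fintype.card_fin]
  have := LinearMap.finrank_range_add_finrank_ker M.mulVecLin
  rw [← hker, Module.finrank_fin_fun] at this
  rw [← hrank]
  exact this

/-- A linear form vanishing on the common kernel of a family of linear forms increases the
dimension of the span if and only if it is not in the span. -/
theorem form_vanishes_of_finrank_le {k ι : Type*} [Field k] {m : ℕ} (a : Option ι → Fin m → k)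
    (h : Module.finrank k (Submodule.span k (Set.range a)) ≤
      Module.finrank k (Submodule.span k (Set.range fun i => a (some i))))
    (v : Fin m → k) (hv : ∀ i, ∑ j, a (some i) j * v j = 0) : ∑ j, a none j * v j = 0 := by
  have hle : Submodule.span k (Set.range fun i => a (some i)) ≤ Submodule.span k (Set.range a) :=
    Submodule.span_mono (Set.range_comp_subset_range some a)
  have heq := Submodule.eq_of_le_of_finrank_le hle h
  exact sum_mul_eq_zero_of_mem_span (heq ▸ Submodule.subset_span ⟨none, rfl⟩) hv

/-- Both families have the same common kernel, so their spans have the same codimension count. -/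
theorem finrank_span_option_le {k ι : Type*} [Field k] {m : ℕ} (a : Option ι → Fin m → k)
    (h : ∀ v : Fin m → k, (∀ i, ∑ j, a (some i) j * v j = 0) → ∑ j, a none j * v j = 0) :
    Module.finrank k (Submodule.span k (Set.range a)) ≤
      Module.finrank k (Submodule.span k (Set.range fun i => a (some i))) := by
  let T : Submodule k (Fin m → k) := ⨅ i : ι, LinearMap.ker (Fintype.linearCombination k (a (some i)))
  have hT : ∀ v, v ∈ T ↔ ∀ i, ∑ j, a (some i) j * v j = 0 := fun v => by
    simp [T, Submodule.mem_iInf, Fintype.linearCombination_apply, mul_comm]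
  have h1 := finrank_annihilator_add (fun i => a (some i)) T hT
  have h2 := finrank_annihilator_add a T fun v => by
    rw [hT]
    refine ⟨fun H i => ?_, fun H i => H (some i)⟩
    cases i with
    | none => exact h v H
    | some i => exact H i
  omega

/-! ### Differentials of a finitely generated domain -/

open scoped KaehlerDifferential

open scoped IntermediateField.algebraAdjoinAdjoin in
/-- In characteristic zero, the differentials of a transcendence basis form a basis of the
module of differentials. -/
theorem rank_kaehlerDifferential_eq_trdeg (k K : Type) [Field k] [CharZero k] [Field K]
    [Algebra k K] : Module.rank K (Ω[K⁄k]) = Algebra.trdeg k K := by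
  obtain ⟨ι, x, hx⟩ := exists_isTranscendenceBasis' k K
  let S := Algebra.adjoin k (Set.range x)
  let E := IntermediateField.adjoin k (Set.range x)
  let P := MvPolynomial ι k
  -- Each stage above the polynomial ring is formally étale: an isomorphism, a localization, and an
  -- algebraic extension that is separable in characteristic zero. Differentials therefore base
  -- change from `P` to `K`.
  have hSE : Algebra.FormallyEtale S E := .of_isLocalization (nonZeroDivisors _)
  have := hx.isAlgebraic_field
  have : CharZero E := charZero_of_injective_algebraMap (algebraMap k E).injective
  have hEK : Algebra.FormallyEtale E K := Algebra.FormallyEtale.of_isSeparable E K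
  have hSK : Algebra.FormallyEtale S K := .comp S E K
  let e : P ≃ₐ[k] S := hx.1.aevalEquiv
  let _ : Algebra P S := e.toRingHom.toAlgebra
  let _ : Algebra P K := ((algebraMap S K).comp e.toRingHom).toAlgebra
  have : IsScalarTower P S K := .of_algebraMap_eq fun _ => rfl
  have : IsScalarTower k P K := .of_algebraMap_eq fun r => by
    change _ = algebraMap S K (e (algebraMap k P r))
    rw [e.commutes]
    rfl
  have hPS : Algebra.FormallyEtale P S :=
    .of_equiv (AlgEquiv.ofRingEquiv (f := e.toRingEquiv) fun _ => rfl : P ≃ₐ[P] S)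
  have hPK : Algebra.FormallyEtale P K := .comp P S K
  let b := (KaehlerDifferential.mvPolynomialBasis k ι).baseChange K
  rw [← (KaehlerDifferential.tensorKaehlerEquivOfFormallyEtale k P K).rank_eq,
    ← b.mk_eq_rank'', hx.cardinalMk_eq_trdeg]

/-- The chain rule. For f in the kernel of `φ` it makes the Jacobian row of f a linear relation
among the differentials of the coordinates. -/
theorem sum_pderiv_smul_D {k A σ : Type*} [Fintype σ] [CommRing k] [CommRing A] [Algebra k A]
    (φ : MvPolynomial σ k →ₐ[k] A) (f : MvPolynomial σ k) :
    ∑ j, φ (pderiv j f) • KaehlerDifferential.D k A (φ (X j)) =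
      KaehlerDifferential.D k A (φ f) := by
  classical
  induction f using MvPolynomial.induction_on with
  | C a => simp [← MvPolynomial.algebraMap_eq]
  | add p q hp hq => simp [add_smul, Finset.sum_add_distrib, hp, hq]
  | mul_X p i hp =>
    simp only [Derivation.leibniz, smul_eq_mul, map_add, map_mul, add_smul,
      Finset.sum_add_distrib, mul_smul, pderiv_X, ← Finset.smul_sum, hp]
    congr 1
    congr 1
    rw [Finset.sum_eq_single i (fun j _ hj => by simp [hj.symm])
      (fun h => absurd (Finset.mem_univ _) h)]
    simp

/-- The Jacobian matrix of the equations of an irreducible affine variety has generic rank at most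
the codimension. -/
theorem finrank_span_jacobian_add_le {m d : ℕ} {k : Type} [Field k] [CharZero k]
    (I : Ideal (MvPolynomial (Fin m) k)) [I.IsPrime] (K : Type) [Field K]
    [Algebra k K] [Algebra (MvPolynomial (Fin m) k ⧸ I) K]
    [IsScalarTower k (MvPolynomial (Fin m) k ⧸ I) K]
    [IsFractionRing (MvPolynomial (Fin m) k ⧸ I) K]
    (hd : Algebra.trdeg k (MvPolynomial (Fin m) k ⧸ I) = d) :
    Module.finrank K (Submodule.span K (Set.range fun (f : I) (j : Fin m) =>
      algebraMap (MvPolynomial (Fin m) k ⧸ I) K (Ideal.Quotient.mk I (pderiv j f.1)))) + d ≤ m := by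
  let A := MvPolynomial (Fin m) k ⧸ I
  let φ : MvPolynomial (Fin m) k →ₐ[k] K :=
    (IsScalarTower.toAlgHom k A K).comp (Ideal.Quotient.mkₐ k I)
  -- `ψ` maps onto the d-dimensional space of differentials and kills the Jacobian rows of `I`, so
  -- these span at most m - d dimensions.
  let ψ := Fintype.linearCombination K fun j => KaehlerDifferential.D k K (φ (X j))
  have hψ : ∀ f, ψ (fun j => φ (pderiv j f)) = KaehlerDifferential.D k K (φ f) := fun f => by
    simpa [ψ, Fintype.linearCombination_apply] using sum_pderiv_smul_D φ f
  have hsurj : LinearMap.range ψ = ⊤ := by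
    rw [eq_top_iff, ← KaehlerDifferential.span_range_derivation k K, Submodule.span_le]
    rintro _ ⟨a, rfl⟩
    obtain ⟨p, q, hq, rfl⟩ := IsFractionRing.div_surjective (A := A) a
    obtain ⟨f, rfl⟩ := Ideal.Quotient.mk_surjective p
    obtain ⟨g, rfl⟩ := Ideal.Quotient.mk_surjective q
    change KaehlerDifferential.D k K (φ f / φ g) ∈ LinearMap.range ψ
    rw [Derivation.leibniz_div, ← hψ, ← hψ]
    exact Submodule.smul_mem _ _ (Submodule.sub_mem _ (Submodule.smul_mem _ _ ⟨_, rfl⟩)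
      (Submodule.smul_mem _ _ ⟨_, rfl⟩))
  have hrank : Module.finrank K (Ω[K⁄k]) = d := by
    have : Algebra.trdeg k K = d := by
      have : Algebra.IsAlgebraic A K := (IsFractionRing.comap_isAlgebraic_iff (K := K)).mpr inferInstance
      rw [← hd, ← trdeg_add_eq k A (A := K), trdeg_eq_zero_iff.mpr this, add_zero]
    rw [Module.finrank, rank_kaehlerDifferential_eq_trdeg, this, Cardinal.toNat_natCast]
  have hle : Submodule.span K (Set.range fun (f : I) (j : Fin m) =>
      algebraMap A K (Ideal.Quotient.mk I (pderiv j f.1))) ≤ LinearMap.ker ψ := by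
    rw [Submodule.span_le]
    rintro _ ⟨f, rfl⟩
    have h0 : φ f = 0 := by
      change algebraMap A K (Ideal.Quotient.mk I f.1) = 0
      rw [Ideal.Quotient.eq_zero_iff_mem.mpr f.2, map_zero]
    have := hψ f
    rw [h0, map_zero] at this
    exact this
  have h1 : Module.finrank K (Submodule.span K (Set.range fun (f : I) (j : Fin m) =>
      algebraMap A K (Ideal.Quotient.mk I (pderiv j f.1)))) ≤ _ := Submodule.finrank_mono hle
  have h2 := LinearMap.finrank_range_add_finrank_ker ψ
  rw [hsurj, finrank_top, hrank, Module.finrank_fin_fun] at h2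
  change Module.finrank K (Submodule.span K (Set.range fun (f : I) (j : Fin m) =>
      algebraMap A K (Ideal.Quotient.mk I (pderiv j f.1)))) + d ≤ m
  omega

/-! ### Scaling of the variables -/

section Scaling

variable {σ : Type}

theorem aeval_smul_of_isHomogeneous [Fintype σ] {f : MvPolynomial σ ℂ} {d : ℕ} (hf : f.IsHomogeneous d)
    (t : ℂ) (w : σ → ℂ) : aeval (t • w) f = t ^ d * aeval w f := by
  rw [aeval_def, aeval_def, eval₂_eq', eval₂_eq', Finset.mul_sum]
  refine Finset.sum_congr rfl fun m hm => ?_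
  have hd : ∑ i, m i = d := by
    rw [← hf (mem_support_iff.mp hm), Finsupp.weight_apply, Finsupp.sum_fintype _ _ (by simp)]
    simp
  simp only [Pi.smul_apply, smul_eq_mul, mul_pow, Finset.prod_mul_distrib, Finset.prod_pow_eq_pow_sum,
    hd]
  ring

/-- A polynomial vanishing on a punctured line through the origin has homogeneous components
vanishing there. -/
theorem aeval_homogeneousComponent_eq_zero [Fintype σ] {f : MvPolynomial σ ℂ} {w : σ → ℂ}
    (h : ∀ t : ℂ, t ≠ 0 → aeval (t • w) f = 0) (d : ℕ) :
    aeval w (homogeneousComponent d f) = 0 := by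
  -- p(t) = f(tw) vanishes for all t ≠ 0, so all its coefficients are zero.
  let p : Polynomial ℂ := ∑ i ∈ Finset.range (f.totalDegree + 1),
    Polynomial.monomial i (aeval w (homogeneousComponent i f))
  have hp : p = 0 := by
    refine Polynomial.eq_zero_of_infinite_isRoot p
      (Set.Infinite.mono ?_ (Set.finite_singleton (0 : ℂ)).infinite_compl)
    intro t ht
    have h1 := h t ht
    rw [← sum_homogeneousComponent f, map_sum] at h1
    simp only [Set.mem_ofPred_eq, Polynomial.IsRoot.def, p, Polynomial.eval_finsetSum,
      Polynomial.eval_monomial]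
    rw [← h1]
    refine Finset.sum_congr rfl fun i _ => ?_
    rw [aeval_smul_of_isHomogeneous (homogeneousComponent_isHomogeneous i f), mul_comm]
  by_cases hd : d ∈ Finset.range (f.totalDegree + 1)
  · have := congrArg (Polynomial.coeff · d) hp
    simpa only [p, Polynomial.finsetSum_coeff, Polynomial.coeff_monomial, Finset.sum_ite_eq',
      hd, if_true, Polynomial.coeff_zero] using this
  · rw [homogeneousComponent_eq_zero _ _ (by simpa using hd), map_zero]

/-- Rescaling of the variables. -/
noncomputable def scale (c : σ → ℂ) : MvPolynomial σ ℂ →ₐ[ℂ] MvPolynomial σ ℂ :=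
  aeval fun i => C (c i) * X i

theorem aeval_scale (c z : σ → ℂ) (f : MvPolynomial σ ℂ) :
    aeval z (scale c f) = aeval (c * z) f := by
  have : (aeval z).comp (scale c) = (aeval (c * z) : MvPolynomial σ ℂ →ₐ[ℂ] ℂ) := by
    ext i
    simp [scale]
  exact DFunLike.congr_fun this f

theorem scale_scale_inv {c : σ → ℂ} (hc : ∀ i, c i ≠ 0) (f : MvPolynomial σ ℂ) :
    scale c (scale c⁻¹ f) = f := by
  have : (scale c).comp (scale c⁻¹) = AlgHom.id ℂ _ := by
    ext i : 1
    simp [scale, ← mul_assoc, ← C_mul, hc]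
  exact DFunLike.congr_fun this f

theorem pderiv_scale (c : σ → ℂ) (i : σ) (f : MvPolynomial σ ℂ) :
    pderiv i (scale c f) = C (c i) * scale c (pderiv i f) := by
  classical
  induction f using MvPolynomial.induction_on with
  | C a => simp [scale]
  | add p q hp hq => simp [hp, hq, mul_add]
  | mul_X p j hp =>
    simp only [map_mul, Derivation.leibniz, smul_eq_mul, hp, map_add, pderiv_X]
    have : scale c (X j) = C (c j) * X j := by simp [scale]
    rw [this, Derivation.leibniz, pderiv_C, pderiv_X]
    by_cases hij : j = i
    · subst hij
      simp
      ring
    · simp [hij]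
      ring

end Scaling

/-! ### Homogeneous coordinates -/

variable {n : ℕ}

theorem IsRep.smul {u : Fin (n + 1) → ℂ} {p : PSpace n} (h : IsRep u p) {a : ℂ} (ha : a ≠ 0) :
    IsRep (a • u) p := by
  obtain ⟨hu, rfl⟩ := h
  exact ⟨smul_ne_zero ha hu, (Projectivization.mk_eq_mk_iff' ..).mpr ⟨a, rfl⟩⟩

theorem IsRep.exists_smul {u u' : Fin (n + 1) → ℂ} {p : PSpace n} (h : IsRep u p)
    (h' : IsRep u' p) : ∃ a : ℂ, a ≠ 0 ∧ u' = a • u := by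
  obtain ⟨hu, rfl⟩ := h
  obtain ⟨hu', h'⟩ := h'
  obtain ⟨a, ha⟩ := (Projectivization.mk_eq_mk_iff' ..).mp h'
  refine ⟨a, ?_, ha.symm⟩
  rintro rfl
  exact hu' (by rw [← ha, zero_smul])

theorem isRep_mk {u : Fin (n + 1) → ℂ} (hu : u ≠ 0) : IsRep u (Projectivization.mk ℂ u hu) :=
  ⟨hu, rfl⟩

theorem isRep_rep (p : PSpace n) : IsRep p.rep p := ⟨p.rep_nonzero, p.mk_rep⟩

theorem IsRep.unique {u : Fin (n + 1) → ℂ} {p q : PSpace n} (h : IsRep u p) (h' : IsRep u q) :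
    p = q := by
  obtain ⟨_, rfl⟩ := h
  obtain ⟨_, rfl⟩ := h'
  rfl

theorem smul_mem_cone {S : Set (PSpace n)} {u : Fin (n + 1) → ℂ} (hu : u ∈ cone S) {a : ℂ}
    (ha : a ≠ 0) : a • u ∈ cone S := by
  obtain ⟨p, hp, h⟩ := hu
  exact ⟨p, hp, h.smul ha⟩

theorem mem_pIdeal {S : Set (PSpace n)} {f : MvPolynomial (Fin (n + 1)) ℂ} :
    f ∈ pIdeal S ↔ ∀ u ∈ cone S, aeval u f = 0 := mem_vanishingIdeal_iff

theorem scale_mem_pIdeal {S : Set (PSpace n)} {f : MvPolynomial (Fin (n + 1)) ℂ}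
    (hf : f ∈ pIdeal S) {a : ℂ} (ha : a ≠ 0) : scale (fun _ => a) f ∈ pIdeal S := by
  rw [mem_pIdeal] at hf ⊢
  intro u hu
  rw [aeval_scale]
  exact hf _ (smul_mem_cone hu ha)

-- The cone is stable under scaling, so its ideal is homogeneous and primality need only be tested
-- on homogeneous f and g, whose zero sets are closed.
attribute [local instance] MvPolynomial.gradedAlgebra in
theorem isPrime_pIdeal {S : Set (PSpace n)} (hS : IsIrreducibleVariety S) :
    (pIdeal S).IsPrime := by
  have hhom : (pIdeal S).IsHomogeneous (homogeneousSubmodule (Fin (n + 1)) ℂ) := by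
    intro i f hf
    have : (DirectSum.decompose (homogeneousSubmodule (Fin (n + 1)) ℂ) f i :
        MvPolynomial (Fin (n + 1)) ℂ) = homogeneousComponent i f :=
      decomposition.decompose'_apply f i
    rw [this]
    rw [mem_pIdeal] at hf ⊢
    exact fun u hu => aeval_homogeneousComponent_eq_zero (fun t ht => hf _ (smul_mem_cone hu ht)) i
  have closed : ∀ f : MvPolynomial (Fin (n + 1)) ℂ, (∃ d, f.IsHomogeneous d) →
      IsZariskiClosed {p : PSpace n | ∀ u, IsRep u p → aeval u f = 0} := by
    rintro f hf
    exact ⟨{f}, by simpa using hf, by simp⟩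
  refine hhom.isPrime_of_homogeneous_mem_or_mem ?_ ?_
  · rw [Ideal.ne_top_iff_one, mem_pIdeal]
    intro h
    obtain ⟨p, hp⟩ := hS.nonempty
    simpa using h p.rep ⟨p, hp, isRep_rep p⟩
  · intro f g hf hg hfg
    rw [mem_pIdeal] at hfg
    obtain ⟨d, hd⟩ := hf
    obtain ⟨e, he⟩ := hg
    refine (hS.irreducible _ _ (closed f ⟨d, hd⟩) (closed g ⟨e, he⟩) ?_).imp ?_ ?_
    · intro p hp
      have h := hfg p.rep ⟨p, hp, isRep_rep p⟩
      rw [map_mul, mul_eq_zero] at h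
      refine h.imp ?_ ?_
      · intro h u hu
        obtain ⟨a, -, rfl⟩ := (isRep_rep p).exists_smul hu
        rw [aeval_smul_of_isHomogeneous hd, h, mul_zero]
      · intro h u hu
        obtain ⟨a, -, rfl⟩ := (isRep_rep p).exists_smul hu
        rw [aeval_smul_of_isHomogeneous he, h, mul_zero]
    all_goals
      intro h
      rw [mem_pIdeal]
      rintro u ⟨p, hp, hu⟩
      exact h hp u hu

/-! ### Tangent spaces and regular points -/

/-- The differentials at `u` of the equations of `S`. -/
noncomputable def jacobian (S : Set (PSpace n)) (u : Fin (n + 1) → ℂ) (f : pIdeal S) (j : Fin (n + 1)) : ℂ :=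
  aeval u (pderiv j f.1)

/-- One representative suffices: the differential of f at au is, up to the factor a, that of the
rescaled equation f(ax) at u. -/
theorem mem_tangentSpace_iff {S : Set (PSpace n)} {p : PSpace n} {u : Fin (n + 1) → ℂ}
    (hu : IsRep u p) (v : Fin (n + 1) → ℂ) :
    v ∈ tangentSpace S p ↔ ∀ f, ∑ j, jacobian S u f j * v j = 0 := by
  constructor
  · exact fun h f => h f.1 f.2 u hu
  · intro h f hf u' hu'
    obtain ⟨a, ha, rfl⟩ := hu.exists_smul hu'
    have h1 := h ⟨_, scale_mem_pIdeal hf ha⟩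
    simp only [jacobian, pderiv_scale, map_mul, aeval_scale, aeval_C, mul_assoc,
      ← Finset.mul_sum] at h1
    exact (mul_eq_zero.mp h1).resolve_left (by simpa using ha)

theorem finrank_span_jacobian_add {S : Set (PSpace n)} {p : PSpace n} {u : Fin (n + 1) → ℂ}
    (hu : IsRep u p) : Module.finrank ℂ (Submodule.span ℂ (Set.range (jacobian S u))) +
      Module.finrank ℂ (tangentSpace S p) = n + 1 :=
  finrank_annihilator_add _ _ (mem_tangentSpace_iff hu)

theorem exists_coneDim_eq (S : Set (PSpace n)) : ∃ d : ℕ, coneDim S = d := by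
  have : coneDim S < Cardinal.aleph0 := trdeg_lt_aleph0_of_finiteType
  exact Cardinal.lt_aleph0.mp this

/-- The Jacobian criterion: the tangent space has at least the dimension of the variety. -/
theorem finrank_span_jacobian_add_le_of_prime {S : Set (PSpace n)} (hS : (pIdeal S).IsPrime)
    {d : ℕ} (hd : coneDim S = d) {u : Fin (n + 1) → ℂ} (hu : u ∈ cone S) :
    Module.finrank ℂ (Submodule.span ℂ (Set.range (jacobian S u))) + d ≤ n + 1 := by
  let K := FractionRing (MvPolynomial (Fin (n + 1)) ℂ ⧸ pIdeal S)
  refine le_trans (Nat.add_le_add_right ?_ d) (finrank_span_jacobian_add_le (pIdeal S) K hd)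
  obtain ⟨s, c, hdet⟩ := (le_finrank_span_iff _).mp
    (le_refl (Module.finrank ℂ (Submodule.span ℂ (Set.range (jacobian S u)))))
  refine (le_finrank_span_iff _).mpr ⟨s, c, ?_⟩
  let M := Matrix.of fun i j => pderiv (c j) (s i).1
  have h1 : aeval u M.det ≠ 0 := by
    rwa [AlgHom.map_det]
  -- A minor nonzero at one point of the cone is nonzero generically, so the rank at a point is at
  -- most the generic rank.
  have h2 : M.det ∉ pIdeal S := fun h => h1 (mem_pIdeal.mp h u hu)
  have h3 : algebraMap (MvPolynomial (Fin (n + 1)) ℂ ⧸ pIdeal S) K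
      (Ideal.Quotient.mk (pIdeal S) M.det) ≠ 0 := by
    rwa [Ne, FaithfulSMul.algebraMap_eq_zero_iff, Ideal.Quotient.eq_zero_iff_mem]
  rwa [RingHom.map_det, RingHom.map_det] at h3

theorem mem_Reg_iff {S : Set (PSpace n)} {d : ℕ} (hd : coneDim S = d) {p : PSpace n}
    {u : Fin (n + 1) → ℂ} (hu : IsRep u p) : p ∈ Reg S ↔ p ∈ S ∧
      Module.finrank ℂ (Submodule.span ℂ (Set.range (jacobian S u))) + d = n + 1 := by
  rw [Reg, Set.mem_ofPred_eq, hd, Nat.cast_inj]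
  have := finrank_span_jacobian_add (S := S) hu
  exact and_congr_right fun _ => by omega

/-- The regular locus of an irreducible variety is Zariski open. -/
theorem exists_basicOpen_subset_Reg {S : Set (PSpace n)} (hS : (pIdeal S).IsPrime)
    {u : Fin (n + 1) → ℂ} (hu : u ∈ cone (Reg S)) :
    ∃ h : MvPolynomial (Fin (n + 1)) ℂ, aeval u h ≠ 0 ∧
      ∀ u' ∈ cone S, aeval u' h ≠ 0 → u' ∈ cone (Reg S) := by
  obtain ⟨d, hd⟩ := exists_coneDim_eq S
  obtain ⟨p, hp, hu⟩ := hu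
  obtain ⟨s, c, hdet⟩ := (le_finrank_span_iff _).mp
    (le_refl (Module.finrank ℂ (Submodule.span ℂ (Set.range (jacobian S u)))))
  have hr := ((mem_Reg_iff hd hu).mp hp).2
  let M := Matrix.of fun i j => pderiv (c j) (s i).1
  -- Where this maximal minor is nonzero the rank is at least the codimension; the Jacobian
  -- criterion bounds it from above.
  refine ⟨M.det, by rwa [AlgHom.map_det], fun u' hu' h => ?_⟩
  rw [AlgHom.map_det] at h
  have h1 := (le_finrank_span_iff (jacobian S u')).mpr ⟨s, c, h⟩
  have h2 := finrank_span_jacobian_add_le_of_prime hS hd hu'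
  obtain ⟨q, hq, hu'⟩ := hu'
  exact ⟨q, (mem_Reg_iff hd hu').mpr ⟨hq, by omega⟩, hu'⟩

theorem pIdeal_anti {A B : Set (PSpace n)} (h : A ⊆ B) : pIdeal B ≤ pIdeal A :=
  vanishingIdeal_anti_mono fun _ ⟨p, hp, hu⟩ => ⟨p, h hp, hu⟩

/-- A subset of a variety containing a nonempty Zariski open subset is dense. -/
theorem pIdeal_eq_of_basicOpen_subset {S V : Set (PSpace n)} (hS : (pIdeal S).IsPrime)
    (hV : V ⊆ S) {h : MvPolynomial (Fin (n + 1)) ℂ} {u : Fin (n + 1) → ℂ} (hu : u ∈ cone S)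
    (hne : aeval u h ≠ 0) (hh : ∀ u' ∈ cone S, aeval u' h ≠ 0 → u' ∈ cone V) :
    pIdeal V = pIdeal S := by
  refine le_antisymm (fun f hf => ?_) (pIdeal_anti hV)
  have h1 : h * f ∈ pIdeal S := by
    rw [mem_pIdeal] at hf ⊢
    intro u' hu'
    by_cases h0 : aeval u' h = 0
    · rw [map_mul, h0, zero_mul]
    · rw [map_mul, hf u' (hh u' hu' h0), mul_zero]
  exact (hS.mem_or_mem h1).resolve_left fun h2 => hne (mem_pIdeal.mp h2 u hu)

theorem tangentSpace_congr {A B : Set (PSpace n)} (h : pIdeal A = pIdeal B) (p : PSpace n) :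
    tangentSpace A p = tangentSpace B p := by
  ext v
  rw [mem_tangentSpace_iff (isRep_rep p), mem_tangentSpace_iff (isRep_rep p)]
  simp only [Subtype.forall, jacobian, h]

theorem coneDim_congr {A B : Set (PSpace n)} (h : pIdeal A = pIdeal B) :
    coneDim A = coneDim B := by
  rw [coneDim, h, coneDim]

/-- Reg(S) is dense in S; this is needed because `WhitneyA` uses the tangent spaces of Reg(X)
itself. -/
theorem tangentSpace_Reg {S : Set (PSpace n)} (hS : (pIdeal S).IsPrime) (hne : (Reg S).Nonempty)
    (p : PSpace n) : tangentSpace (Reg S) p = tangentSpace S p := by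
  obtain ⟨q, hq⟩ := hne
  obtain ⟨h, h1, h2⟩ := exists_basicOpen_subset_Reg hS ⟨q, hq, isRep_rep q⟩
  exact tangentSpace_congr
    (pIdeal_eq_of_basicOpen_subset hS (fun _ h => h.1) ⟨q, hq.1, isRep_rep q⟩ h1 h2) p

/-! ### Ideals invariant under bihomogeneous scaling -/

/-- The scaling of the two groups of variables by `a` and `b`. -/
def biScalar (a b : ℂ) : Fin (n + 1) ⊕ Fin (n + 1) → ℂ := Sum.elim (fun _ => a) fun _ => b

/-- Invariance under independent scaling of the two groups of variables. -/
def BiInvariant (I : Ideal (MvPolynomial (Fin (n + 1) ⊕ Fin (n + 1)) ℂ)) : Prop :=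
  ∀ a b : ℂ, a ≠ 0 → b ≠ 0 → I ≤ I.comap (scale (biScalar a b))

theorem mem_biCone_iff {W : Set (PSpace n × PSpace n)} {u w : Fin (n + 1) → ℂ} :
    Sum.elim u w ∈ biCone W ↔ ∃ q ∈ W, IsRep u q.1 ∧ IsRep w q.2 := Iff.rfl

theorem biScalar_mul (a b : ℂ) (u w : Fin (n + 1) → ℂ) :
    biScalar a b * Sum.elim u w = Sum.elim (a • u) (b • w) := by
  ext (i | i) <;> simp [biScalar]

theorem biScalar_mul_mem_biCone {W : Set (PSpace n × PSpace n)}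
    {z : Fin (n + 1) ⊕ Fin (n + 1) → ℂ} (hz : z ∈ biCone W) {a b : ℂ} (ha : a ≠ 0) (hb : b ≠ 0) :
    biScalar a b * z ∈ biCone W := by
  obtain ⟨q, hq, h1, h2⟩ := hz
  exact ⟨q, hq, h1.smul ha, h2.smul hb⟩

theorem mem_biIdeal {W : Set (PSpace n × PSpace n)}
    {f : MvPolynomial (Fin (n + 1) ⊕ Fin (n + 1)) ℂ} :
    f ∈ biIdeal W ↔ ∀ z ∈ biCone W, aeval z f = 0 := mem_vanishingIdeal_iff

theorem biInvariant_biIdeal (W : Set (PSpace n × PSpace n)) : BiInvariant (biIdeal W) := by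
  intro a b ha hb f hf
  rw [Ideal.mem_comap, mem_biIdeal]
  intro z hz
  rw [aeval_scale]
  exact mem_biIdeal.mp hf _ (biScalar_mul_mem_biCone hz ha hb)

theorem biInvariant_map_pIdeal (S : Set (PSpace n)) :
    BiInvariant ((pIdeal S).map (rename (Sum.inl : Fin (n + 1) → Fin (n + 1) ⊕ Fin (n + 1)))) := by
  intro a b ha hb
  rw [Ideal.map_le_iff_le_comap]
  intro f hf
  rw [Ideal.mem_comap, Ideal.mem_comap]
  have : scale (biScalar a b) (rename Sum.inl f) =
      rename (Sum.inl : Fin (n + 1) → Fin (n + 1) ⊕ Fin (n + 1)) (scale (fun _ => a) f) := by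
    have : (scale (biScalar a b)).comp (rename Sum.inl) =
        (rename (Sum.inl : Fin (n + 1) → Fin (n + 1) ⊕ Fin (n + 1))).comp
          (scale fun _ => a) := by
      ext i : 1
      simp [scale, biScalar]
    exact DFunLike.congr_fun this f
  rw [this]
  exact Ideal.mem_map_of_mem _ (scale_mem_pIdeal hf ha)

theorem BiInvariant.sup {I J : Ideal (MvPolynomial (Fin (n + 1) ⊕ Fin (n + 1)) ℂ)}
    (hI : BiInvariant I) (hJ : BiInvariant J) : BiInvariant (I ⊔ J) := fun a b ha hb =>
  sup_le ((hI a b ha hb).trans (Ideal.comap_mono le_sup_left))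
    ((hJ a b ha hb).trans (Ideal.comap_mono le_sup_right))

theorem BiInvariant.pow {I : Ideal (MvPolynomial (Fin (n + 1) ⊕ Fin (n + 1)) ℂ)}
    (hI : BiInvariant I) (N : ℕ) : BiInvariant (I ^ N) := fun a b ha hb =>
  (Ideal.pow_right_mono (hI a b ha hb) N).trans (Ideal.le_comap_pow _ N)

theorem BiInvariant.saturation {I J : Ideal (MvPolynomial (Fin (n + 1) ⊕ Fin (n + 1)) ℂ)}
    (hI : BiInvariant I) (hJ : BiInvariant J) : BiInvariant (saturation I J) := by
  intro a b ha hb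
  have hle : ∀ N : ℕ, I.colon ((J ^ N : Ideal (MvPolynomial (Fin (n + 1) ⊕ Fin (n + 1)) ℂ)) :
      Set (MvPolynomial (Fin (n + 1) ⊕ Fin (n + 1)) ℂ)) ≤ ProjVar.saturation I J :=
    fun N => by rw [ProjVar.saturation]; exact le_iSup_iff.mpr fun _ h => h N
  conv_lhs => rw [ProjVar.saturation]
  refine iSup_le fun N g hg => ?_
  refine hle N ?_
  rw [Submodule.mem_colon]
  intro f hf
  have hinv : (biScalar a b : Fin (n + 1) ⊕ Fin (n + 1) → ℂ)⁻¹ = biScalar a⁻¹ b⁻¹ := by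
    ext (i | i) <;> simp [biScalar]
  have h1 : scale (biScalar a⁻¹ b⁻¹) f ∈ J ^ N :=
    hJ.pow N _ _ (inv_ne_zero ha) (inv_ne_zero hb) hf
  have h2 := hI a b ha hb (Submodule.mem_colon.mp hg _ h1)
  have hne : ∀ i, (biScalar a b : Fin (n + 1) ⊕ Fin (n + 1) → ℂ) i ≠ 0 := by
    rintro (i | i)
    exacts [ha, hb]
  rwa [Ideal.mem_comap, smul_eq_mul, map_mul, ← hinv, scale_scale_inv hne] at h2

theorem biInvariant_satIdeal (X Y : Set (PSpace n)) : BiInvariant (satIdeal X Y) :=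
  ((biInvariant_biIdeal _).sup (biInvariant_map_pIdeal _)).saturation
    ((biInvariant_biIdeal _).sup (biInvariant_biIdeal _))

theorem mem_biZeros_of_isRep {I : Ideal (MvPolynomial (Fin (n + 1) ⊕ Fin (n + 1)) ℂ)}
    (hI : BiInvariant I) {u w : Fin (n + 1) → ℂ} {q : PSpace n × PSpace n} (hu : IsRep u q.1)
    (hw : IsRep w q.2) (h : ∀ f ∈ I, aeval (Sum.elim u w) f = 0) : q ∈ biZeros I := by
  rintro z ⟨_, rfl, hz1, hz2⟩
  obtain ⟨a, ha, h1⟩ := hu.exists_smul hz1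
  obtain ⟨b, hb, h2⟩ := hw.exists_smul hz2
  have hz : z = biScalar a b * Sum.elim u w := by
    rw [biScalar_mul, ← h1, ← h2, Sum.elim_comp_inl_inr]
  rw [mem_zeroLocus_iff]
  intro f hf
  rw [hz, ← aeval_scale]
  exact h _ (hI a b ha hb hf)

theorem aeval_eq_zero_of_mem_biZeros {I : Ideal (MvPolynomial (Fin (n + 1) ⊕ Fin (n + 1)) ℂ)}
    {u w : Fin (n + 1) → ℂ} {q : PSpace n × PSpace n} (hu : IsRep u q.1)
    (hw : IsRep w q.2) (h : q ∈ biZeros I) {f : MvPolynomial (Fin (n + 1) ⊕ Fin (n + 1)) ℂ}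
    (hf : f ∈ I) : aeval (Sum.elim u w) f = 0 :=
  mem_zeroLocus_iff.mp (h (mem_biCone_iff.mpr ⟨q, rfl, hu, hw⟩)) f hf

/-- In a Noetherian ring, the saturation is reached with a single power. -/
theorem exists_pow_of_saturation {R : Type*} [CommRing R] [IsNoetherianRing R] (I J : Ideal R) :
    ∃ N : ℕ, ∀ g ∈ saturation I J, ∀ f ∈ J, g * f ^ N ∈ I := by
  have hmono : Monotone fun N : ℕ => I.colon ((J ^ N : Ideal R) : Set R) := by
    intro M N hMN g hg
    rw [Submodule.mem_colon] at hg ⊢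
    exact fun f hf => hg f (Ideal.pow_le_pow_right hMN hf)
  obtain ⟨N, hN⟩ := monotone_stabilizes_iff_noetherian.mpr ‹IsNoetherianRing R› ⟨_, hmono⟩
  refine ⟨N, fun g hg f hf => ?_⟩
  obtain ⟨M, hM⟩ := (Submodule.mem_iSup_of_directed _ hmono.directed_le).mp hg
  have h : g ∈ I.colon ((J ^ N : Ideal R) : Set R) := by
    rcases le_total M N with h | h
    · exact hmono h hM
    · have := hN M h
      simp only [OrderHom.coe_mk] at this
      rwa [this]
  exact Submodule.mem_colon.mp h _ (Ideal.pow_mem_pow hf N)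

/-! ### Elimination -/

section Elimination

variable {σ : Type}

/-- Polynomials in two groups of variables as polynomials in the second group. -/
noncomputable def curry : MvPolynomial (σ ⊕ σ) ℂ →ₐ[ℂ] MvPolynomial σ (MvPolynomial σ ℂ) :=
  aeval (Sum.elim (fun i => C (X i)) X)

/-- Substitution of values for the first group of variables. -/
noncomputable def specialize (u : σ → ℂ) : MvPolynomial (σ ⊕ σ) ℂ →ₐ[ℂ] MvPolynomial σ ℂ :=
  (mapAlgHom (aeval u)).comp curry

theorem aeval_specialize (u w : σ → ℂ) (f : MvPolynomial (σ ⊕ σ) ℂ) :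
    aeval w (specialize u f) = aeval (Sum.elim u w) f := by
  have : (aeval w).comp (specialize u) =
      (aeval (Sum.elim u w) : MvPolynomial (σ ⊕ σ) ℂ →ₐ[ℂ] ℂ) := by
    ext (i | i) <;> simp [specialize, curry]
  exact DFunLike.congr_fun this f

theorem specialize_surjective (u : σ → ℂ) : Function.Surjective (specialize u) := by
  intro f
  refine ⟨rename Sum.inr f, ?_⟩
  have : (specialize u).comp (rename Sum.inr) = AlgHom.id ℂ (MvPolynomial σ ℂ) := by
    ext i : 1
    simp [specialize, curry]
  exact DFunLike.congr_fun this f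

theorem coeff_specialize (u : σ → ℂ) (f : MvPolynomial (σ ⊕ σ) ℂ) (m : σ →₀ ℕ) :
    coeff m (specialize u f) = aeval u (coeff m (curry f)) := by
  simp [specialize, coeff_map]

theorem homogeneousComponent_eq_sum [Fintype σ] [DecidableEq σ] (d : ℕ) (f : MvPolynomial σ ℂ) :
    homogeneousComponent d f =
      ∑ m : (Finset.univ.finsuppAntidiag d : Finset (σ →₀ ℕ)), monomial m.1 (coeff m.1 f) := by
  ext m
  rw [coeff_homogeneousComponent, coeff_sum]
  simp only [coeff_monomial]
  have hdeg : m ∈ (Finset.univ.finsuppAntidiag d : Finset (σ →₀ ℕ)) ↔ m.degree = d := by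
    simp [Finsupp.degree_eq_sum]
  rw [Finset.sum_coe_sort (Finset.univ.finsuppAntidiag d : Finset (σ →₀ ℕ))
    (fun m' => if m' = m then coeff m' f else 0), Finset.sum_ite_eq']
  simp only [hdeg]

/-- The main theorem of elimination theory: if the fibre over `u` of the closed set defined
by `Q` is empty, there is a polynomial not vanishing at `u` but vanishing on the projection of
that set. -/
theorem exists_eliminant {Q : Ideal (MvPolynomial (Fin (n + 1) ⊕ Fin (n + 1)) ℂ)}
    (hQ : BiInvariant Q) (u : Fin (n + 1) → ℂ)
    (hu : ∀ w : Fin (n + 1) → ℂ, w ≠ 0 → ∃ f ∈ Q, aeval (Sum.elim u w) f ≠ 0) :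
    ∃ h : MvPolynomial (Fin (n + 1)) ℂ, aeval u h ≠ 0 ∧ ∀ u' w' : Fin (n + 1) → ℂ, w' ≠ 0 →
      (∀ f ∈ Q, aeval (Sum.elim u' w') f = 0) → aeval u' h = 0 := by
  classical
  let Qu := Q.map (specialize u)
  -- The specialized ideal has no zero except possibly the origin, so by the Nullstellensatz it
  -- contains all monomials of some degree `D`.
  have hrad : idealOfVars (Fin (n + 1)) ℂ ≤ Qu.radical := by
    rw [← vanishingIdeal_zeroLocus_eq_radical (K := ℂ), idealOfVars, Ideal.span_le]
    rintro _ ⟨i, rfl⟩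
    rw [SetLike.mem_coe, mem_vanishingIdeal_iff]
    intro w hw
    have : w = 0 := by
      by_contra hne
      obtain ⟨f, hf, hf0⟩ := hu w hne
      rw [← aeval_specialize] at hf0
      exact hf0 (mem_zeroLocus_iff.mp hw _ (Ideal.mem_map_of_mem _ hf))
    simp [this]
  obtain ⟨D, hD⟩ := Ideal.exists_pow_le_of_le_radical_of_fg hrad (idealOfVars_fg _ _)
  let B := (Finset.univ.finsuppAntidiag D : Finset (Fin (n + 1) →₀ ℕ))
  have hB : ∀ m : B, ∃ g ∈ Q, specialize u g = monomial m.1 1 := by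
    intro m
    refine (Ideal.mem_map_iff_of_surjective _ (specialize_surjective u)).mp (hD ?_)
    rw [monomial_mem_pow_idealOfVars_iff _ _ one_ne_zero]
    have := (Finset.mem_finsuppAntidiag.mp m.2).1
    rw [Finsupp.degree_eq_sum, this]
  choose g hgQ hg using hB
  -- Row m holds the degree-`D` coefficients of `g m` in the second variables. At `u` this is the
  -- identity matrix; at `u'` the degree-`D` monomials in `w'` form a nonzero kernel vector.
  let A : Matrix B B (MvPolynomial (Fin (n + 1)) ℂ) :=
    Matrix.of fun m m' => coeff m'.1 (curry (g m))
  have hA : ∀ u' : Fin (n + 1) → ℂ, aeval u' A.det =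
      (Matrix.of fun m m' : B => coeff m'.1 (specialize u' (g m))).det := by
    intro u'
    rw [AlgHom.map_det]
    simp only [coeff_specialize]
    rfl
  refine ⟨A.det, ?_, fun u' w' hw' h0 => ?_⟩
  · rw [hA]
    have : (Matrix.of fun m m' : B => coeff m'.1 (specialize u (g m))) = 1 := by
      ext m m'
      simp only [Matrix.of_apply, hg, coeff_monomial, Matrix.one_apply, Subtype.coe_inj]
    rw [this, Matrix.det_one]
    exact one_ne_zero
  · rw [hA, ← Matrix.exists_mulVec_eq_zero_iff]
    refine ⟨fun m => ∏ i, w' i ^ m.1 i, ?_, ?_⟩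
    · obtain ⟨i, hi⟩ := Function.ne_iff.mp hw'
      refine Function.ne_iff.mpr ⟨⟨Finsupp.single i D, ?_⟩, ?_⟩
      · simp [B]
      · rw [Pi.zero_apply, Finset.prod_eq_single i]
        · simpa using pow_ne_zero D hi
        · intro j _ hj
          simp [Finsupp.single_eq_of_ne hj]
        · simp
    · ext m
      have h1 := aeval_homogeneousComponent_eq_zero (f := specialize u' (g m)) (w := w')
        (fun t ht => by
          rw [aeval_specialize]
          have := h0 _ (hQ 1 t one_ne_zero ht (hgQ m))
          rwa [aeval_scale, biScalar_mul, one_smul] at this) D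
      rw [homogeneousComponent_eq_sum, map_sum] at h1
      simp only [aeval_monomial] at h1
      rw [Pi.zero_apply, ← h1]
      refine Finset.sum_congr rfl fun m' _ => ?_
      simp [Finsupp.prod_fintype]

end Elimination

/-! ### Conormal spaces -/

/-- The conormal bundle over the regular points, whose closure is the conormal space. -/
def conormalReg (S : Set (PSpace n)) : Set (PSpace n × PSpace n) :=
  {q | q.1 ∈ Reg S ∧ Annihilates q.2 (tangentSpace S q.1)}

/-- Closure does not change the vanishing ideal, so equations can be checked on honest conormal
vectors at regular points. -/
theorem biIdeal_conormal (S : Set (PSpace n)) : biIdeal (conormal S) = biIdeal (conormalReg S) := by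
  refine le_antisymm (vanishingIdeal_anti_mono ?_) ?_
  · rintro z ⟨q, hq, hz⟩
    refine ⟨q, ?_, hz⟩
    rintro z' ⟨_, rfl, hz'⟩
    exact mem_zeroLocus_iff.mpr fun f hf => mem_biIdeal.mp hf _ ⟨_, hq, hz'⟩
  · intro f hf
    rw [mem_biIdeal]
    rintro z ⟨q, hq, hz⟩
    exact mem_zeroLocus_iff.mp (hq ⟨q, rfl, hz⟩) f hf

theorem mem_conormal_of_isRep {S : Set (PSpace n)} {u w : Fin (n + 1) → ℂ} {q : PSpace n × PSpace n}
    (hu : IsRep u q.1) (hw : IsRep w q.2)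
    (h : ∀ f ∈ biIdeal (conormalReg S), aeval (Sum.elim u w) f = 0) : q ∈ conormal S :=
  mem_biZeros_of_isRep (biInvariant_biIdeal _) hu hw h

theorem annihilates_of_isRep {w : Fin (n + 1) → ℂ} {l : PSpace n} (hw : IsRep w l)
    {T : Submodule ℂ (Fin (n + 1) → ℂ)} (h : ∀ v ∈ T, ∑ i, w i * v i = 0) : Annihilates l T := by
  intro w' hw' v hv
  obtain ⟨a, -, rfl⟩ := hw.exists_smul hw'
  simp [mul_assoc, ← Finset.mul_sum, h v hv]

/-- Over the regular points of `S`, the conormal space consists of conormal vectors only. -/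
theorem sum_mul_eq_zero_of_conormal {S : Set (PSpace n)} {y : PSpace n} (hy : y ∈ Reg S)
    {u w : Fin (n + 1) → ℂ} (hu : IsRep u y)
    (h : ∀ f ∈ biIdeal (conormalReg S), aeval (Sum.elim u w) f = 0) {v : Fin (n + 1) → ℂ}
    (hv : v ∈ tangentSpace S y) : ∑ i, w i * v i = 0 := by
  obtain ⟨d, hd⟩ := exists_coneDim_eq S
  -- The Jacobian bordered by the covector. At conormal vectors the border adds no rank, so minors
  -- of size codimension plus one vanish there and hence at (u, w). The Jacobian has full rank at
  -- the regular point `y`, so `w` lies in its row span.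
  let row (z : Fin (n + 1) ⊕ Fin (n + 1) → ℂ) : Option (pIdeal S) → Fin (n + 1) → ℂ :=
    fun o j => o.elim (z (Sum.inr j)) fun f => jacobian S (z ∘ Sum.inl) f j
  let A : Option (pIdeal S) → Fin (n + 1) → MvPolynomial (Fin (n + 1) ⊕ Fin (n + 1)) ℂ :=
    fun o j => o.elim (X (Sum.inr j)) fun f => rename Sum.inl (pderiv j f.1)
  have hA : ∀ z o j, aeval z (A o j) = row z o j := by
    intro z o j
    cases o with
    | none => simp [A, row]
    | some f => simp [A, row, jacobian, aeval_rename]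
  refine form_vanishes_of_finrank_le (row (Sum.elim u w)) ?_ v
    ((mem_tangentSpace_iff hu v).mp hv)
  by_contra hlt
  rw [not_le, Nat.lt_iff_add_one_le] at hlt
  obtain ⟨s, c, hdet⟩ := (le_finrank_span_iff _).mp hlt
  let M := Matrix.of fun i j => A (s i) (c j)
  have hM : ∀ z, aeval z M.det = (Matrix.of fun i j => row z (s i) (c j)).det := by
    intro z
    rw [AlgHom.map_det]
    simp only [← hA]
    rfl
  refine hdet ?_
  rw [← hM]
  refine h _ (mem_biIdeal.mpr ?_)
  rintro z ⟨q, ⟨hq, hann⟩, hz1, hz2⟩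
  by_contra hne
  rw [hM] at hne
  have h1 := (le_finrank_span_iff (row z)).mpr ⟨s, c, hne⟩
  have h2 := finrank_span_option_le (row z) fun v hv =>
    hann _ hz2 v ((mem_tangentSpace_iff hz1 v).mpr hv)
  have h3 := ((mem_Reg_iff hd hz1).mp hq).2
  have h4 := ((mem_Reg_iff hd hu).mp hy).2
  change Module.finrank ℂ (Submodule.span ℂ (Set.range (jacobian S u))) + 1 ≤ _ at h1
  change _ ≤ Module.finrank ℂ (Submodule.span ℂ (Set.range (jacobian S (z ∘ Sum.inl)))) at h2
  omega

/-! ### The good locus -/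

variable {X Y : Set (PSpace n)}

theorem fibreIdeal_le_satIdeal : fibreIdeal X Y ≤ satIdeal X Y := by
  rw [satIdeal, saturation]
  refine le_trans (fun g hg => ?_) (le_iSup _ 0)
  rw [Submodule.mem_colon]
  exact fun f _ => Ideal.mul_mem_right f _ hg

theorem exists_satIdeal_ne_zero {y : PSpace n} (hy : y ∈ goodLocus X Y) {u w : Fin (n + 1) → ℂ}
    (hu : IsRep u y) (hw : w ≠ 0) : ∃ g ∈ satIdeal X Y, aeval (Sum.elim u w) g ≠ 0 := by
  by_contra! h
  let q : PSpace n × PSpace n := (y, Projectivization.mk ℂ w hw)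
  have hq : q ∈ conormal X := mem_conormal_of_isRep hu (isRep_mk hw) fun f hf =>
    h f (fibreIdeal_le_satIdeal (le_sup_left (a := biIdeal (conormal X))
      (by rwa [biIdeal_conormal])))
  exact hy.2 ⟨⟨q, hq⟩, mem_biZeros_of_isRep (biInvariant_satIdeal X Y) hu (isRep_mk hw) h, rfl⟩

/-- Take the product of a Jacobian minor, cutting out a neighbourhood inside Reg(Y), and an
eliminant that vanishes on the projection of V(Q). -/
theorem exists_basicOpen_subset_goodLocus (hY : (pIdeal Y).IsPrime) {u : Fin (n + 1) → ℂ}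
    (hu : u ∈ cone (goodLocus X Y)) :
    ∃ h : MvPolynomial (Fin (n + 1)) ℂ, aeval u h ≠ 0 ∧
      ∀ u' ∈ cone Y, aeval u' h ≠ 0 → u' ∈ cone (goodLocus X Y) := by
  obtain ⟨y, hy, hu⟩ := hu
  obtain ⟨h₁, h₁u, h₁Y⟩ := exists_basicOpen_subset_Reg hY ⟨y, hy.1, hu⟩
  obtain ⟨h₂, h₂u, h₂Q⟩ := exists_eliminant (biInvariant_satIdeal X Y) u
    fun w hw => exists_satIdeal_ne_zero hy hu hw
  refine ⟨h₁ * h₂, by rw [map_mul]; exact mul_ne_zero h₁u h₂u, fun u' hu' hne => ?_⟩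
  rw [map_mul, mul_ne_zero_iff] at hne
  obtain ⟨p, hp, hpu⟩ := h₁Y u' hu' hne.1
  refine ⟨p, ⟨hp, ?_⟩, hpu⟩
  rintro ⟨⟨q, hqX⟩, hq, rfl⟩
  exact hne.2 (h₂Q u' q.2.rep q.2.rep_nonzero fun f hf =>
    aeval_eq_zero_of_mem_biZeros hpu (isRep_rep q.2) hq hf)

theorem goodLocus_subset : goodLocus X Y ⊆ Y := fun _ h => h.1.1

theorem pIdeal_goodLocus (hY : (pIdeal Y).IsPrime) (hne : (goodLocus X Y).Nonempty) :
    pIdeal (goodLocus X Y) = pIdeal Y := by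
  obtain ⟨y, hy⟩ := hne
  obtain ⟨h, h1, h2⟩ := exists_basicOpen_subset_goodLocus hY ⟨y, hy, isRep_rep y⟩
  exact pIdeal_eq_of_basicOpen_subset hY goodLocus_subset ⟨y, hy.1.1, isRep_rep y⟩ h1 h2

theorem mem_Reg_goodLocus (hY : (pIdeal Y).IsPrime) {y : PSpace n} (hy : y ∈ goodLocus X Y) :
    y ∈ Reg (goodLocus X Y) := by
  have h := pIdeal_goodLocus hY ⟨y, hy⟩
  refine ⟨hy, ?_⟩
  rw [tangentSpace_congr h, coneDim_congr h]
  exact hy.1.2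

theorem fibreIdeal_le_fibreIdeal_goodLocus :
    fibreIdeal X Y ≤ fibreIdeal X (goodLocus X Y) :=
  sup_le_sup_left (Ideal.map_mono (pIdeal_anti goodLocus_subset)) _

/-- The ideals of `C(X) ∩ C(U)` and `κ_X⁻¹(U)`, where `U` is the good locus. -/
theorem interIdeal_le_radical_preimageIdeal (hY : (pIdeal Y).IsPrime) :
    interIdeal X (goodLocus X Y) ≤ (preimageIdeal X (goodLocus X Y)).radical := by
  -- `N` is chosen before the point: a single power of F must work for all germs.
  obtain ⟨N, hN⟩ := exists_pow_of_saturation (fibreIdeal X Y) (interIdeal X Y)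
  refine sup_le (fun F hF => Ideal.le_radical ?_) fun F hF => ⟨N, ?_⟩
  · exact fun z _ => ⟨1, by simp, by rw [one_mul]; exact Ideal.mem_sup_left hF⟩
  · rintro z ⟨_, ⟨⟨q, hq⟩, hqU, rfl⟩, hz1, hz2⟩
    obtain ⟨h, hz, hh⟩ := exists_basicOpen_subset_goodLocus hY ⟨q.1, hqU, hz1⟩
    obtain ⟨g, hg, hgz⟩ := exists_satIdeal_ne_zero hqU hz1 hz2.1
    rw [Sum.elim_comp_inl_inr] at hgz
    -- At a conormal vector of Y either the base point is outside U and h vanishes, or it lies in U,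
    -- where Y and U have the same conormal vectors and F vanishes.
    have hhF : rename Sum.inl h * F ∈ interIdeal X Y := by
      refine Ideal.mem_sup_right ?_
      rw [biIdeal_conormal, mem_biIdeal] at hF ⊢
      rintro z' ⟨q', hq', hz1', hz2'⟩
      rw [map_mul, aeval_rename]
      by_cases h0 : aeval (z' ∘ Sum.inl) h = 0
      · rw [h0, zero_mul]
      · obtain ⟨p, hp, hpz⟩ := hh _ ⟨q'.1, hq'.1.1, hz1'⟩ h0
        rw [hpz.unique hz1'] at hp
        refine mul_eq_zero_of_right _ (hF z' ⟨q', ⟨mem_Reg_goodLocus hY hp, ?_⟩, hz1', hz2'⟩)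
        rw [tangentSpace_congr (pIdeal_goodLocus hY ⟨_, hp⟩)]
        exact hq'.2
    refine ⟨g * rename Sum.inl h ^ N, ?_, fibreIdeal_le_fibreIdeal_goodLocus ?_⟩
    · rw [map_mul, map_pow, aeval_rename]
      exact mul_ne_zero hgz (pow_ne_zero N hz)
    · have := hN g hg _ hhF
      rwa [mul_pow, ← mul_assoc] at this

/-- Over the good locus, `C(X)` is contained in `C(Y)`. -/
theorem aeval_eq_zero_of_mem_goodLocus {y : PSpace n} (hy : y ∈ goodLocus X Y)
    {u w : Fin (n + 1) → ℂ} (hu : IsRep u y) (hw : w ≠ 0)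
    (hX : ∀ f ∈ biIdeal (conormalReg X), aeval (Sum.elim u w) f = 0)
    {f : MvPolynomial (Fin (n + 1) ⊕ Fin (n + 1)) ℂ} (hf : f ∈ biIdeal (conormalReg Y)) :
    aeval (Sum.elim u w) f = 0 := by
  obtain ⟨N, hN⟩ := exists_pow_of_saturation (fibreIdeal X Y) (interIdeal X Y)
  obtain ⟨g, hg, hgz⟩ := exists_satIdeal_ne_zero hy hu hw
  -- (u, w) satisfies the equations of C(X) and u those of Y, so g·f^N vanishes there while g does
  -- not.
  have hle : fibreIdeal X Y ≤ RingHom.ker (aeval (Sum.elim u w) : _ →ₐ[ℂ] ℂ) := by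
    refine sup_le ?_ (Ideal.map_le_iff_le_comap.mpr ?_)
    · rw [biIdeal_conormal]
      exact hX
    · intro p hp
      rw [Ideal.mem_comap, RingHom.mem_ker, aeval_rename]
      exact mem_pIdeal.mp hp _ ⟨y, hy.1.1, hu⟩
  have h := hle (hN g hg f (Ideal.mem_sup_right (by rwa [biIdeal_conormal])))
  rw [RingHom.mem_ker, map_mul, map_pow] at h
  exact eq_zero_of_pow_eq_zero ((mul_eq_zero.mp h).resolve_left hgz)

/-! ### Limits of conormal vectors -/

theorem orthProj_toLp_of_mem {T : Submodule ℂ (Fin (n + 1) → ℂ)} {v : Fin (n + 1) → ℂ}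
    (hv : v ∈ T) : orthProj T (WithLp.toLp 2 v) = WithLp.toLp 2 v :=
  Submodule.starProjection_eq_self_iff.mpr ⟨v, hv, rfl⟩

theorem ofLp_orthProj_mem (T : Submodule ℂ (Fin (n + 1) → ℂ))
    (x : EuclideanSpace ℂ (Fin (n + 1))) : (orthProj T x).ofLp ∈ T := by
  obtain ⟨v, hv, h⟩ := Submodule.starProjection_apply_mem
    (T.map (WithLp.linearEquiv 2 ℂ (Fin (n + 1) → ℂ)).symm.toLinearMap) x
  rw [orthProj, ← h]
  exact hv

theorem sum_star_mul (x y : EuclideanSpace ℂ (Fin (n + 1))) :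
    ∑ i, star (x i) * y i = inner ℂ x y := by
  simp [PiLp.inner_apply, mul_comm]

/-- Conjugation turns the orthogonal residual into a linear form annihilating T, that is, a conormal
covector. -/
theorem sum_star_sub_orthProj_mul (T : Submodule ℂ (Fin (n + 1) → ℂ))
    (x : EuclideanSpace ℂ (Fin (n + 1))) {v : Fin (n + 1) → ℂ} (hv : v ∈ T) :
    ∑ i, star ((x - orthProj T x) i) * v i = 0 := by
  rw [sum_star_mul _ (WithLp.toLp 2 v)]
  exact Submodule.inner_left_of_mem_orthogonal
    (K := T.map (WithLp.linearEquiv 2 ℂ (Fin (n + 1) → ℂ)).symm.toLinearMap) ⟨v, hv, rfl⟩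
    (Submodule.sub_starProjection_mem_orthogonal x)

theorem isRep_of_mem_submodule {p : PSpace n} {u : Fin (n + 1) → ℂ} (hu : u ∈ p.submodule)
    (h0 : u ≠ 0) : IsRep u p := by
  rw [Projectivization.submodule_eq, Submodule.mem_span_singleton] at hu
  obtain ⟨a, rfl⟩ := hu
  exact (isRep_rep p).smul fun ha => h0 (by rw [ha, zero_smul])

theorem IsRep.mem_submodule {p : PSpace n} {u : Fin (n + 1) → ℂ} (hu : IsRep u p) :
    u ∈ p.submodule := by
  obtain ⟨hu, rfl⟩ := hu
  rw [Projectivization.submodule_mk]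
  exact Submodule.mem_span_singleton_self u

theorem tendsto_ofLp_orthProj {T : ℕ → Submodule ℂ (Fin (n + 1) → ℂ)}
    {T₀ : Submodule ℂ (Fin (n + 1) → ℂ)} (h : SubspaceTendsto T T₀)
    (x : EuclideanSpace ℂ (Fin (n + 1))) :
    Tendsto (fun k => orthProj (T k) x) atTop (𝓝 (orthProj T₀ x)) :=
  ((ContinuousLinearMap.apply ℂ _ x).continuous.tendsto _).comp h

theorem whitneyA_goodLocus (hX : (pIdeal X).IsPrime) : WhitneyA (Reg X) (goodLocus X Y) := by
  intro y hy x hx hxy T hT v hv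
  have hvY : v ∈ tangentSpace Y y := fun f hf => hv f (pIdeal_anti goodLocus_subset hf)
  simp only [tangentSpace_Reg hX ⟨x 0, hx 0⟩] at hT
  obtain ⟨u, hu⟩ : ∃ u, IsRep u y := ⟨_, isRep_rep y⟩
  let v' : EuclideanSpace ℂ (Fin (n + 1)) := WithLp.toLp 2 v
  let d := v' - orthProj T v'
  let dk (k : ℕ) := v' - orthProj (tangentSpace X (x k)) v'
  have hd : Tendsto dk atTop (𝓝 d) := (tendsto_ofLp_orthProj hT v').const_sub v'
  by_cases hd0 : d = 0
  · have hv' : v' = orthProj T v' := sub_eq_zero.mp hd0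
    have := ofLp_orthProj_mem T v'
    rwa [← hv'] at this
  exfalso
  -- Projecting `u` to the lines x_k gives coordinate vectors converging to `u`, hence eventually
  -- nonzero.
  let uk (k : ℕ) : Fin (n + 1) → ℂ := (orthProj (x k).submodule (WithLp.toLp 2 u)).ofLp
  have hofLp := PiLp.continuous_ofLp 2 fun _ : Fin (n + 1) => ℂ
  have huk : Tendsto uk atTop (𝓝 u) := by
    have := (hofLp.tendsto _).comp (tendsto_ofLp_orthProj hxy (WithLp.toLp 2 u))
    rwa [orthProj_toLp_of_mem hu.mem_submodule] at this
  have hwk : Tendsto (fun k => star (dk k).ofLp) atTop (𝓝 (star d.ofLp)) :=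
    (continuous_star.tendsto _).comp ((hofLp.tendsto _).comp hd)
  have hw0 : star d.ofLp ≠ 0 := by
    rw [Ne, star_eq_zero]
    exact fun h => hd0 (WithLp.ofLp_injective 2 h)
  have hlim : ∀ f ∈ biIdeal (conormalReg X), aeval (Sum.elim u (star d.ofLp)) f = 0 := by
    intro f hf
    have hcont : Continuous fun p : (Fin (n + 1) → ℂ) × (Fin (n + 1) → ℂ) =>
        aeval (Sum.elim p.1 p.2) f := by
      simp only [aeval_eq_eval]
      refine (continuous_eval f).comp (continuous_pi ?_)
      rintro (i | i)
      · exact (continuous_apply i).comp continuous_fst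
      · exact (continuous_apply i).comp continuous_snd
    have htend := (hcont.tendsto (u, star d.ofLp)).comp (huk.prodMk_nhds hwk)
    refine tendsto_nhds_unique htend (tendsto_const_nhds.congr' ?_)
    filter_upwards [huk.eventually_ne hu.1, hwk.eventually_ne hw0] with k hk1 hk2
    refine (mem_biIdeal.mp hf _ (mem_biCone_iff.mpr ⟨(x k, Projectivization.mk ℂ _ hk2),
      ⟨hx k, annihilates_of_isRep (isRep_mk hk2) fun t ht => ?_⟩,
      isRep_of_mem_submodule (ofLp_orthProj_mem _ _) hk1, isRep_mk hk2⟩)).symm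
    exact sum_star_sub_orthProj_mul _ v' ht
  have hsum := sum_mul_eq_zero_of_conormal hy.1 hu
    (fun f hf => aeval_eq_zero_of_mem_goodLocus hy hu hw0 hlim hf) hvY
  -- `d` is orthogonal to both `v'` and its projection, hence to their difference, which is `d`
  -- itself.
  have h1 : inner ℂ d v' = 0 := by
    rw [← sum_star_mul]
    exact hsum
  have h2 : inner ℂ d (orthProj T v') = 0 := by
    rw [← sum_star_mul]
    exact sum_star_sub_orthProj_mul T v' (ofLp_orthProj_mem T v')
  refine hd0 (inner_self_eq_zero (𝕜 := ℂ).mp ?_)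
  change inner ℂ d (v' - orthProj T v') = 0
  rw [inner_sub_right, h1, h2, sub_zero]

end ProjVar

theorem lemma5p4 {n : ℕ} (X Y : Set (ProjVar.PSpace n))
    (hX : ProjVar.IsIrreducibleVariety X) (hY : ProjVar.IsIrreducibleVariety Y)
    (hYX : Y ⊂ X) :
    (ProjVar.interIdeal X (ProjVar.goodLocus X Y)).radical ≤
        (ProjVar.preimageIdeal X (ProjVar.goodLocus X Y)).radical ∧
      ProjVar.WhitneyA (ProjVar.Reg X) (ProjVar.goodLocus X Y) :=
  ⟨Ideal.radical_le_radical_iff.mpr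
      (ProjVar.interIdeal_le_radical_preimageIdeal (ProjVar.isPrime_pIdeal hY)),
    ProjVar.whitneyA_goodLocus (ProjVar.isPrime_pIdeal hX)⟩
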